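/- Call a power series $f(q)=\frac{1}{2a_0}+\sum_{n\ge 1}a_nq^n$ over a commutative ring $R$ (so $a_0\in R$ and $2a_0$ is invertible) normalized multiplicative if $a_1=1$ and $a_{mn}=a_ma_n$ for all relatively prime positive integers $m,n$. Call $f\in R[[q]]$ multiplicative if $\lambda f$ is normalized multiplicative for some $\lambda\in R$. Proposition. There is a unique cusp form $\Delta$ of weight $12$ and level $1$ (that is, for $\mathrm{SL}_2(\mathbb{Z})$) whose $q$-expansion has $q$-coefficient equal to $1$, and its $q$-expansion has integer coefficients. Let $\bar\Delta\in\mathbb{F}_{13}[[q]]$ be the reduction mod $13$ of this $q$-expansion. Then $\bar f=2+\bar\Delta$ is normalized multiplicative in $\mathbb{F}_{13}[[q]]$, and its square $\bar f^2$ is multiplicative. -/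

import Mathlib

open scoped MatrixGroups PowerSeries

/-- A power series `f = 1/(2a₀) + ∑_{n ≥ 1} aₙ qⁿ` is *normalized multiplicative* if `a₁ = 1` and
`a_{mn} = a_m a_n` for all relatively prime positive integers `m`, `n`. The first clause says
that the constant term has the form `1/(2a₀)`. -/
def IsNormalizedMultiplicative {R : Type*} [CommRing R] (f : R⟦X⟧) : Prop :=
  (∃ a₀ : R, 2 * a₀ * f.coeff 0 = 1) ∧
  f.coeff 1 = 1 ∧
  ∀ m n : ℕ, 0 < m → 0 < n → Nat.Coprime m n → f.coeff (m * n) = f.coeff m * f.coeff n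

/-- A power series is *multiplicative* if some scalar multiple of it is normalized
multiplicative. -/
def IsMultiplicativeSeries {R : Type*} [CommRing R] (f : R⟦X⟧) : Prop :=
  ∃ c : R, IsNormalizedMultiplicative (c • f)

/-- A cusp form of level one is *normalized* if the coefficient of `q` in its `q`-expansion
at the cusp `∞` is `1`. -/
def IsNormalizedCuspForm {k : ℤ} (g : CuspForm 𝒮ℒ k) : Prop :=
  (UpperHalfPlane.qExpansion 1 g).coeff 1 = 1

/-! Multiplicativity is deduced from Hecke eigenforms: a series with `a₁ = 1` that is an eigenvector
of every `T_p` has multiplicative coefficients (`coeff_mul_of_heckeSeries_eq_smul`). Constant terms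
play no part in this, so only `Δ̄` and `f̄² = 4 + 4Δ̄ + Δ̄²` without its constant term matter.
Weight 12 cusp forms are the multiples of `Δ`, so `Δ` is an eigenform. Weight 24 cusp forms are
spanned by `ΔE₁₂` and `Δ²`. Mod 13 the series `691 E₁₂` is the constant 2, and `p²³ = p¹¹`, so the
weight 12 operators preserve the span of `Δ̄` and `Δ̄²` (`exists_heckeSeries_deltaBar_sq`). There
`T₂` has the distinct eigenvalues 2 and -1, with eigenvectors `Δ̄` and `Δ̄ + 10Δ̄²`. Each `T_p`
commutes with `T₂`, hence preserves the second eigenline (`exists_heckeSeries_eigenBar`). Finally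
`10 f̄² = 1 + Δ̄ + 10Δ̄²`. -/

namespace LevelOneHecke

open UpperHalfPlane hiding I
open Complex
open scoped ModularForm

/-- The `p`-th Hecke operator with multiplier `χ` on power series:
`∑ aₙ qⁿ ↦ ∑ (a_{pn} + χ a_{n/p}) qⁿ`. -/
noncomputable def heckeSeries {R : Type*} [CommRing R] (χ : R) (p : ℕ) (h : R⟦X⟧) : R⟦X⟧ :=
  PowerSeries.mk fun n ↦ h.coeff (p * n) + χ * if p ∣ n then h.coeff (n / p) else 0

/-! ### Hecke operators on level one modular forms -/

section Analytic

variable {k : ℤ} {p : ℕ}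

/-- Denominators are cleared so that each use reduces to a polynomial identity between complex
numbers. -/
lemma apply_ofComplex_of_moebius (f : ModularForm 𝒮ℒ k) {a b c d : ℤ} (hdet : a * d - b * c = 1)
    {w w' : ℂ} (hw : 0 < w.im) (hw' : w' * (c * w + d) = a * w + b) :
    f (ofComplex w') = (c * w + d) ^ k * f (ofComplex w) := by
  let γ : SL(2, ℤ) := ⟨!![a, b; c, d], by rw [Matrix.det_fin_two_of, hdet]⟩
  have hne : (c * w + d : ℂ) ≠ 0 := by
    have := denom_ne_zero (γ : GL (Fin 2) ℝ) ⟨w, hw⟩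
    rw [ModularGroup.denom_apply] at this
    simpa [γ] using this
  have hγ : γ • (⟨w, hw⟩ : ℍ) = ofComplex w' := by
    have h1 : ((γ • (⟨w, hw⟩ : ℍ) : ℍ) : ℂ) = w' := by
      rw [specialLinearGroup_apply]
      simp [γ]
      rw [div_eq_iff hne, hw']
    rw [← h1, ofComplex_apply]
  have h := SlashInvariantForm.slash_action_eqn' f (γ := (γ : GL (Fin 2) ℝ))
    (MonoidHom.mem_range.mpr ⟨γ, rfl⟩) ⟨w, hw⟩
  rw [ofComplex_apply_of_im_pos hw, ← hγ]
  have hc : (γ : GL (Fin 2) ℝ) 1 0 = (c : ℝ) := rfl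
  have hd : (γ : GL (Fin 2) ℝ) 1 1 = (d : ℝ) := rfl
  rw [hc, hd] at h
  exact_mod_cast h

lemma hasSum_qExpansion_ofComplex (f : ModularForm 𝒮ℒ k) {w : ℂ} (hw : 0 < w.im) :
    HasSum (fun m ↦ (qExpansion 1 f).coeff m * exp (2 * Real.pi * I * w) ^ m)
      (f (ofComplex w)) := by
  have := ModularForm.hasSum_qExpansion f one_pos one_mem_strictPeriods_SL ⟨w, hw⟩
  rw [ofComplex_apply_of_im_pos hw]
  simpa [Function.Periodic.qParam] using this

variable [Fact p.Prime]

variable (p) in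
/-- The function underlying `T_p f`. -/
noncomputable def heckeFun (f : ModularForm 𝒮ℒ k) (τ : ℍ) : ℂ :=
  (p : ℂ) ^ (k - 1) * f (ofComplex (p * τ)) +
    (p : ℂ)⁻¹ * ∑ x : ZMod p, f (ofComplex ((τ + x.val) / p))

lemma im_natCast_mul_pos (τ : ℍ) : 0 < ((p : ℂ) * τ).im := by
  have : 0 < p := (Fact.out : p.Prime).pos
  simp [this, τ.im_pos]

lemma im_add_div_natCast_pos (x : ℕ) {τ : ℂ} (hτ : 0 < τ.im) : 0 < ((τ + x) / (p : ℂ)).im := by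
  have : 0 < p := (Fact.out : p.Prime).pos
  rw [← ofReal_natCast p, div_ofReal_im]
  simp
  positivity

lemma sum_exp_val_div (m : ℕ) :
    ∑ x : ZMod p, exp (2 * Real.pi * I * (x.val / p)) ^ m = if p ∣ m then (p : ℂ) else 0 := by
  have h := AddChar.sum_mulShift (m : ZMod p) (ZMod.isPrimitive_stdAddChar p)
  rw [ZMod.card] at h
  have h2 : ∀ x : ZMod p, ZMod.stdAddChar (x * (m : ZMod p)) =
      exp (2 * Real.pi * I * (x.val / p)) ^ m := by
    intro x
    have : x * (m : ZMod p) = (((x.val * m : ℕ) : ℤ) : ZMod p) := by simp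
    rw [this, ZMod.stdAddChar_coe, ← exp_nat_mul]
    push_cast
    ring_nf
  simp_rw [h2, ZMod.natCast_eq_zero_iff] at h
  rw [h]; split_ifs <;> simp

lemma hasSum_heckeFun (f : ModularForm 𝒮ℒ k) (τ : ℍ) :
    HasSum (fun m ↦ (heckeSeries ((p : ℂ) ^ (k - 1)) p (qExpansion 1 f)).coeff m •
      Function.Periodic.qParam 1 τ ^ m) (heckeFun p f τ) := by
  have hp : 0 < p := (Fact.out : p.Prime).pos
  have hp0 : (p : ℂ) ≠ 0 := by exact_mod_cast hp.ne'
  have hinj : Function.Injective (fun m : ℕ ↦ p * m) := fun a b h ↦ Nat.eq_of_mul_eq_mul_left hp h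
  set q := Function.Periodic.qParam 1 τ with hq
  have hqe : q = exp (2 * Real.pi * I * τ) := by simp [hq, Function.Periodic.qParam]
  have h1 : HasSum (fun m : ℕ ↦ (if p ∣ m then (qExpansion 1 f).coeff (m / p) else 0) * q ^ m)
      (f (ofComplex (p * τ))) := by
    rw [← hinj.hasSum_iff]
    · convert hasSum_qExpansion_ofComplex f (im_natCast_mul_pos (p := p) τ) using 2 with m
      simp only [Function.comp, dvd_mul_right, if_true, Nat.mul_div_cancel_left _ hp]
      rw [hqe, pow_mul, ← exp_nat_mul]
      ring_nf
    · intro m hm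
      rw [if_neg, zero_mul]
      rintro ⟨c, rfl⟩
      exact hm ⟨c, rfl⟩
  have h2 : HasSum (fun m : ℕ ↦ (qExpansion 1 f).coeff (p * m) * q ^ m)
      ((p : ℂ)⁻¹ * ∑ x : ZMod p, f (ofComplex ((τ + x.val) / p))) := by
    have h3 := (hasSum_sum (s := Finset.univ) fun (x : ZMod p) _ ↦ hasSum_qExpansion_ofComplex f
      (im_add_div_natCast_pos (p := p) x.val τ.im_pos)).mul_left (p : ℂ)⁻¹
    rw [← hinj.hasSum_iff] at h3
    · refine (congrArg (HasSum · _) (funext fun m ↦ ?_)).mp h3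
      simp only [Function.comp, ← Finset.mul_sum]
      have : ∀ x : ZMod p, exp (2 * Real.pi * I * ((τ + x.val) / p)) ^ (p * m) = q ^ m := by
        intro x
        rw [pow_mul, ← exp_nat_mul, hqe]
        congr 1
        rw [exp_eq_exp_iff_exists_int]
        refine ⟨x.val, ?_⟩
        field_simp
        push_cast
        ring
      simp only [this, Finset.sum_const, Finset.card_univ, ZMod.card, nsmul_eq_mul]
      field_simp
    · intro m hm
      -- For `p ∤ m`, averaging over `x` kills the term by orthogonality of additive characters.
      have : ∀ x : ZMod p, exp (2 * Real.pi * I * ((τ + x.val) / p)) ^ m =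
          exp (2 * Real.pi * I * (τ / p)) ^ m * exp (2 * Real.pi * I * (x.val / p)) ^ m := by
        intro x
        rw [← mul_pow, ← exp_add]
        ring_nf
      simp only [← Finset.mul_sum, this]
      rw [sum_exp_val_div, if_neg]
      · simp
      · rintro ⟨c, rfl⟩
        exact hm ⟨c, rfl⟩
  refine (congrArg (HasSum · _) (funext fun m ↦ ?_)).mp
    ((h1.mul_left ((p : ℂ) ^ (k - 1))).add h2)
  simp only [heckeSeries, PowerSeries.coeff_mk, smul_eq_mul]
  ring

/-- Immediate from the expansion in powers of `q`, which is 1-periodic. -/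
lemma heckeFun_slash_T (f : ModularForm 𝒮ℒ k) :
    heckeFun p f ∣[k] ModularGroup.T = heckeFun p f := by
  ext τ
  rw [ModularForm.SL_slash_apply, ModularGroup.denom_apply]
  have hq : Function.Periodic.qParam 1 ((ModularGroup.T • τ : ℍ) : ℂ) =
      Function.Periodic.qParam 1 τ := by
    rw [modular_T_smul]
    simp only [Function.Periodic.qParam, coe_vadd]
    rw [exp_eq_exp_iff_exists_int]
    exact ⟨1, by push_cast; ring⟩
  have h1 := hasSum_heckeFun (p := p) f (ModularGroup.T • τ)
  rw [hq] at h1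
  rw [h1.unique (hasSum_heckeFun f τ)]
  simp [ModularGroup.T]

lemma sum_erase_zero_slash_S (f : ModularForm 𝒮ℒ k) (τ : ℍ) :
    ∑ x ∈ Finset.univ.erase (0 : ZMod p), f (ofComplex ((-(τ : ℂ)⁻¹ + x.val) / p)) =
      (τ : ℂ) ^ k * ∑ x ∈ Finset.univ.erase (0 : ZMod p), f (ofComplex ((τ + x.val) / p)) := by
  have hp0 : (p : ℂ) ≠ 0 := by exact_mod_cast (Fact.out : p.Prime).ne_zero
  have hτ := τ.ne_zero
  rw [Finset.mul_sum]
  refine Finset.sum_nbij' (fun x ↦ -x⁻¹) (fun x ↦ -x⁻¹) ?_ ?_ ?_ ?_ ?_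
  · simp
  · simp
  · simp [inv_neg]
  · simp [inv_neg]
  · intro x hx
    have hx0 : x ≠ 0 := by simpa using hx
    -- With `y = -x⁻¹` and `1 + xy = pt`, the matrix `(x, -t; p, -y)` has determinant 1 and sends
    -- `(τ + y)/p` to `(-1/τ + x)/p`, with automorphy factor `τ`.
    obtain ⟨t, ht⟩ : (p : ℤ) ∣ 1 + x.val * (-x⁻¹ : ZMod p).val := by
      rw [← ZMod.intCast_zmod_eq_zero_iff_dvd]
      push_cast
      simp [hx0]
    have htc : (1 : ℂ) + x.val * (-x⁻¹ : ZMod p).val = p * t := by exact_mod_cast ht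
    set y := (-x⁻¹ : ZMod p).val
    have := apply_ofComplex_of_moebius f (a := x.val) (b := -t) (c := p) (d := -y)
      (by linear_combination -ht) (im_add_div_natCast_pos (p := p) y τ.im_pos)
      (w' := (-(τ : ℂ)⁻¹ + x.val) / p) (by
        push_cast
        field_simp
        linear_combination (-1 : ℂ) * τ * htc)
    rw [this]
    congr 2
    push_cast
    field_simp
    ring

/-- `S` exchanges the `pτ` term with the `x = 0` term and permutes the others. -/
lemma heckeFun_slash_S (f : ModularForm 𝒮ℒ k) :
    heckeFun p f ∣[k] ModularGroup.S = heckeFun p f := by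
  have hp : 0 < p := (Fact.out : p.Prime).pos
  have hp0 : (p : ℂ) ≠ 0 := by exact_mod_cast hp.ne'
  ext τ
  have hτ := τ.ne_zero
  have hS : ((ModularGroup.S • τ : ℍ) : ℂ) = -(τ : ℂ)⁻¹ := by
    rw [modular_S_smul]
    simp [inv_neg]
  rw [ModularForm.SL_slash_apply, ModularGroup.denom_S, zpow_neg, ← div_eq_mul_inv,
    div_eq_iff (zpow_ne_zero _ hτ)]
  have h1 : f (ofComplex (p * -(τ : ℂ)⁻¹)) = (τ / p : ℂ) ^ k * f (ofComplex ((τ : ℂ) / p)) := by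
    simpa using apply_ofComplex_of_moebius f (a := 0) (b := -1) (c := 1) (d := 0) (by ring)
      (w := τ / p) (w' := p * -(τ : ℂ)⁻¹) (by simpa using im_add_div_natCast_pos (p := p) 0 τ.im_pos)
      (by push_cast; field_simp; ring)
  have h2 : f (ofComplex (-(τ : ℂ)⁻¹ / p)) = (p * τ : ℂ) ^ k * f (ofComplex (p * τ)) := by
    simpa using apply_ofComplex_of_moebius f (a := 0) (b := -1) (c := 1) (d := 0) (by ring)
      (w := p * τ) (w' := -(τ : ℂ)⁻¹ / p) (im_natCast_mul_pos (p := p) τ)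
      (by push_cast; field_simp; ring)
  simp only [heckeFun, hS]
  rw [← Finset.add_sum_erase _ _ (Finset.mem_univ (0 : ZMod p)), sum_erase_zero_slash_S,
    ← Finset.add_sum_erase _ (fun x : ZMod p ↦ f (ofComplex ((τ + x.val) / p)))
      (Finset.mem_univ (0 : ZMod p))]
  simp only [ZMod.val_zero, Nat.cast_zero, add_zero, h1, h2]
  rw [div_zpow, mul_zpow, zpow_sub_one₀ hp0]
  have hpk : (p : ℂ) ^ k ≠ 0 := zpow_ne_zero _ hp0
  field_simp
  ring

lemma differentiableOn_comp_ofComplex (f : ModularForm 𝒮ℒ k) {g : ℂ → ℂ} (hg : Differentiable ℂ g)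
    (hpos : ∀ z : ℂ, 0 < z.im → 0 < (g z).im) :
    DifferentiableOn ℂ (fun z ↦ f (ofComplex (g z))) {z | 0 < z.im} :=
  (UpperHalfPlane.mdifferentiable_iff.mp f.holo').comp hg.differentiableOn hpos

lemma mdifferentiable_heckeFun (f : ModularForm 𝒮ℒ k) :
    MDifferentiable (modelWithCornersSelf ℂ ℂ) (modelWithCornersSelf ℂ ℂ) (heckeFun p f) := by
  rw [UpperHalfPlane.mdifferentiable_iff]
  have : DifferentiableOn ℂ (fun z : ℂ ↦ (p : ℂ) ^ (k - 1) * f (ofComplex (p * z)) +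
      (p : ℂ)⁻¹ * ∑ x : ZMod p, f (ofComplex ((z + x.val) / p))) {z | 0 < z.im} := by
    refine ((differentiableOn_comp_ofComplex f (by fun_prop)
      fun z hz ↦ im_natCast_mul_pos ⟨z, hz⟩).const_mul _).add (DifferentiableOn.const_mul
        (DifferentiableOn.fun_sum fun x _ ↦ differentiableOn_comp_ofComplex f (by fun_prop)
          fun z hz ↦ im_add_div_natCast_pos _ hz) _)
  refine this.congr fun z hz ↦ ?_
  simp only [Function.comp, heckeFun, ofComplex_apply_of_im_pos (show 0 < z.im from hz)]

variable (p) in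
/-- The Hecke operator `T_p` on modular forms of level one. -/
noncomputable def hecke (f : ModularForm 𝒮ℒ k) : ModularForm 𝒮ℒ k where
  toFun := heckeFun p f
  slash_action_eq' A hA := by
    obtain ⟨A, rfl⟩ := hA
    exact SlashInvariantForm.slash_action_generators_SL2Z (heckeFun_slash_S f) (heckeFun_slash_T f) A
  holo' := mdifferentiable_heckeFun f
  bdd_at_cusps' hc := by
    rw [Subgroup.IsArithmetic.isCusp_iff_isCusp_SL2Z] at hc
    rw [OnePoint.isBoundedAt_iff_forall_SL2Z hc]
    intro γ _
    rw [SlashInvariantForm.slash_action_generators_SL2Z (heckeFun_slash_S f) (heckeFun_slash_T f)]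
    exact isBoundedAtImInfty_of_hasSum_qExpansion one_pos (hasSum_heckeFun f)

lemma qExpansion_hecke (f : ModularForm 𝒮ℒ k) :
    qExpansion 1 (hecke p f) = heckeSeries ((p : ℂ) ^ (k - 1)) p (qExpansion 1 f) := by
  ext m
  exact (ModularFormClass.qExpansion_coeff_unique one_pos one_mem_strictPeriods_SL
    (f := hecke p f) (hasSum_heckeFun f) m).symm

end Analytic

/-! ### Integral `q`-expansions of `Δ` and `691 E₁₂` -/

/-- The power series `∑ σ_k(n) qⁿ`. -/
noncomputable def sigmaSeries (k : ℕ) : ℤ⟦X⟧ :=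
  PowerSeries.mk fun n ↦ (ArithmeticFunction.sigma k n : ℤ)

/-- The power series `∑ (5 σ₃(n) + 7 σ₅(n)) / 12 qⁿ`. -/
noncomputable def sigmaThreeFiveSeries : ℤ⟦X⟧ :=
  PowerSeries.mk fun n ↦ ∑ d ∈ n.divisors, (5 * (d : ℤ) ^ 3 + 7 * (d : ℤ) ^ 5) / 12

/-- The `q`-expansion of the modular discriminant, with integer coefficients. -/
noncomputable def deltaSeries : ℤ⟦X⟧ :=
  sigmaThreeFiveSeries + 100 * sigmaSeries 3 ^ 2 + 8000 * sigmaSeries 3 ^ 3 -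
    147 * sigmaSeries 5 ^ 2

/-- The `q`-expansion of `691 E₁₂`. -/
noncomputable def eisensteinTwelveSeries : ℤ⟦X⟧ := 691 + 65520 * sigmaSeries 11

lemma twelve_dvd_five_mul_cube_add (d : ℤ) : 12 ∣ 5 * d ^ 3 + 7 * d ^ 5 := by
  have h : ∀ x : ZMod 12, 5 * x ^ 3 + 7 * x ^ 5 = 0 := by decide
  refine (ZMod.intCast_zmod_eq_zero_iff_dvd _ 12).mp ?_
  push_cast
  exact h d

lemma twelve_mul_sigmaThreeFiveSeries :
    12 * sigmaThreeFiveSeries = 5 * sigmaSeries 3 + 7 * sigmaSeries 5 := by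
  ext n
  rw [show (12 : ℤ⟦X⟧) = PowerSeries.C 12 from rfl, show (5 : ℤ⟦X⟧) = PowerSeries.C 5 from rfl,
    show (7 : ℤ⟦X⟧) = PowerSeries.C 7 from rfl]
  simp only [map_add, PowerSeries.coeff_C_mul, sigmaThreeFiveSeries, sigmaSeries,
    PowerSeries.coeff_mk, ArithmeticFunction.sigma_apply, Nat.cast_sum, Finset.mul_sum,
    ← Finset.sum_add_distrib]
  refine Finset.sum_congr rfl fun d _ ↦ ?_
  rw [Int.mul_ediv_cancel' (twelve_dvd_five_mul_cube_add d)]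
  push_cast
  rfl

/-- In the expanded right side only the linear part `720 σ₃ + 1008 σ₅ = 144 (5σ₃ + 7σ₅)` is not
visibly divisible by 1728; `sigmaThreeFiveSeries` supplies the missing factor 12. -/
lemma mul_deltaSeries :
    1728 * deltaSeries = (1 + 240 * sigmaSeries 3) ^ 3 - (1 - 504 * sigmaSeries 5) ^ 2 := by
  unfold deltaSeries
  linear_combination 144 * twelve_mul_sigmaThreeFiveSeries

lemma coeff_sigmaSeries_zero (k : ℕ) : (sigmaSeries k).coeff 0 = 0 := by simp [sigmaSeries]

lemma qExpansion_E {k : ℕ} (hk : 3 ≤ k) (hk2 : Even k) {c : ℂ}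
    (hc : -(2 * k / bernoulli k : ℂ) = c) :
    qExpansion 1 (ModularForm.E hk) =
      1 + c • (sigmaSeries (k - 1)).map (Int.castRingHom ℂ) := by
  ext n
  rw [EisensteinSeries.E_qExpansion_coeff hk hk2, hc, map_add, PowerSeries.coeff_one,
    PowerSeries.coeff_smul, PowerSeries.coeff_map]
  split_ifs with h
  · simp [h, sigmaSeries]
  · simp [sigmaSeries]

lemma qExpansion_E₄ : qExpansion 1 ModularForm.E₄ =
    (1 + 240 * sigmaSeries 3).map (Int.castRingHom ℂ) := by
  rw [qExpansion_E (by norm_num) ⟨2, rfl⟩ (c := 240)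
    (by norm_num [show bernoulli 4 = -1 / 30 by decide +kernel])]
  simp [Algebra.smul_def]
  exact .inl (map_ofNat _ _).symm

lemma qExpansion_E₆ : qExpansion 1 ModularForm.E₆ =
    (1 - 504 * sigmaSeries 5).map (Int.castRingHom ℂ) := by
  rw [qExpansion_E (by norm_num) ⟨3, rfl⟩ (c := -504)
    (by norm_num [show bernoulli 6 = 1 / 42 by decide +kernel])]
  simp [Algebra.smul_def, sub_eq_add_neg]
  exact .inl (map_ofNat _ _).symm

lemma mul_qExpansion_E_twelve :
    691 * qExpansion 1 (ModularForm.E (by norm_num : 3 ≤ 12)) =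
      eisensteinTwelveSeries.map (Int.castRingHom ℂ) := by
  rw [qExpansion_E (by norm_num) ⟨6, rfl⟩ (c := 65520 / 691)
    (by norm_num [show bernoulli 12 = -691 / 2730 by decide +kernel])]
  ext n
  simp only [eisensteinTwelveSeries, map_add, map_mul, map_ofNat]
  rw [show (691 : ℂ⟦X⟧) = PowerSeries.C 691 from rfl,
    show (65520 : ℂ⟦X⟧) = PowerSeries.C 65520 from rfl, mul_add, mul_one, map_add,
    PowerSeries.coeff_C_mul, PowerSeries.coeff_C_mul, PowerSeries.coeff_smul, smul_eq_mul]
  ring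

lemma map_deltaSeries :
    deltaSeries.map (Int.castRingHom ℂ) = qExpansion 1 CuspForm.discriminant := by
  have h1 : (1728 : ℂ) • (CuspForm.discriminant : ℍ → ℂ) =
      ((ModularForm.E₄.pow 3 : ModularForm 𝒮ℒ _) : ℍ → ℂ) -
        ((ModularForm.E₆.pow 2 : ModularForm 𝒮ℒ _) : ℍ → ℂ) := by
    ext z
    rw [Pi.sub_apply, ModularForm.coe_pow, ModularForm.coe_pow]
    simp [ModularForm.discriminant_eq_E₄_cube_sub_E₆_sq]
    ring
  have h2 := congrArg (qExpansion 1) h1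
  rw [ModularForm.qExpansion_smul one_pos one_mem_strictPeriods_SL,
    ModularForm.qExpansion_sub one_pos one_mem_strictPeriods_SL,
    ModularForm.qExpansion_pow one_pos one_mem_strictPeriods_SL,
    ModularForm.qExpansion_pow one_pos one_mem_strictPeriods_SL, qExpansion_E₄, qExpansion_E₆,
    ← map_pow, ← map_pow, ← map_sub, ← mul_deltaSeries, map_mul, map_ofNat,
    show (1728 : ℂ⟦X⟧) = PowerSeries.C 1728 from rfl, ← PowerSeries.smul_eq_C_mul] at h2
  exact (smul_right_injective _ (OfNat.ofNat_ne_zero 1728) h2).symm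

lemma coeff_deltaSeries_zero : deltaSeries.coeff 0 = 0 := by
  simp [deltaSeries, sigmaThreeFiveSeries, sigmaSeries]

lemma coeff_deltaSeries_of_le_three :
    deltaSeries.coeff 1 = 1 ∧ deltaSeries.coeff 2 = -24 ∧ deltaSeries.coeff 3 = 252 := by
  have e : ∀ k n, (sigmaSeries k).coeff n = (ArithmeticFunction.sigma k n : ℤ) := fun k n ↦ by
    simp [sigmaSeries]
  have h2 : (2 : ℕ).divisors = {1, 2} := rfl
  have h3 : (3 : ℕ).divisors = {1, 3} := rfl
  rw [deltaSeries, show (100 : ℤ⟦X⟧) = PowerSeries.C 100 from rfl,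
    show (8000 : ℤ⟦X⟧) = PowerSeries.C 8000 from rfl,
    show (147 : ℤ⟦X⟧) = PowerSeries.C 147 from rfl]
  simp only [map_add, map_sub, PowerSeries.coeff_C_mul]
  simp [pow_succ, PowerSeries.coeff_mul, Finset.Nat.antidiagonal_succ, e,
    sigmaThreeFiveSeries, ArithmeticFunction.sigma_apply, h2, h3,
    -PowerSeries.coeff_zero_eq_constantCoeff]

/-! ### Formal Hecke operators and multiplicativity -/

section Algebraic

variable {R : Type*} [CommRing R]

@[simp]
lemma coeff_heckeSeries (χ : R) (p : ℕ) (h : R⟦X⟧) (n : ℕ) :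
    (heckeSeries χ p h).coeff n =
      h.coeff (p * n) + χ * if p ∣ n then h.coeff (n / p) else 0 := by
  simp [heckeSeries]

lemma heckeSeries_add (χ : R) (p : ℕ) (g h : R⟦X⟧) :
    heckeSeries χ p (g + h) = heckeSeries χ p g + heckeSeries χ p h := by
  ext n
  simp only [coeff_heckeSeries, map_add]
  split_ifs <;> ring

lemma heckeSeries_smul (χ a : R) (p : ℕ) (h : R⟦X⟧) :
    heckeSeries χ p (a • h) = a • heckeSeries χ p h := by
  ext n
  simp only [coeff_heckeSeries, PowerSeries.coeff_smul, smul_eq_mul]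
  split_ifs <;> ring

lemma map_heckeSeries {S : Type*} [CommRing S] (φ : R →+* S) (χ : R) (p : ℕ) (h : R⟦X⟧) :
    (heckeSeries χ p h).map φ = heckeSeries (φ χ) p (h.map φ) := by
  ext n
  simp only [coeff_heckeSeries, PowerSeries.coeff_map, map_add, map_mul]
  split_ifs <;> simp

lemma heckeSeries_comm (χ ψ : R) {p q : ℕ} (hpq : p.Coprime q) (h : R⟦X⟧) :
    heckeSeries χ p (heckeSeries ψ q h) = heckeSeries ψ q (heckeSeries χ p h) := by
  ext n
  have h1 : q ∣ p * n ↔ q ∣ n := hpq.symm.dvd_mul_left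
  have h2 : p ∣ q * n ↔ p ∣ n := hpq.dvd_mul_left
  simp only [coeff_heckeSeries, h1, h2]
  rw [show q * (p * n) = p * (q * n) by ring]
  by_cases hp : p ∣ n <;> by_cases hq : q ∣ n
  · have h3 : q ∣ n / p := hpq.symm.dvd_of_dvd_mul_left (by rwa [Nat.mul_div_cancel' hp])
    have h4 : p ∣ n / q := hpq.dvd_of_dvd_mul_left (by rwa [Nat.mul_div_cancel' hq])
    simp only [hp, hq, h3, h4, if_true, Nat.mul_div_assoc _ hp, Nat.mul_div_assoc _ hq,
      Nat.div_div_eq_div_mul, mul_comm q p]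
    ring
  · have h3 : ¬ q ∣ n / p := fun h ↦ hq (h.trans (Nat.div_dvd_of_dvd hp))
    simp only [hp, hq, h3, if_true, if_false, Nat.mul_div_assoc _ hp]
    ring
  · have h4 : ¬ p ∣ n / q := fun h ↦ hp (h.trans (Nat.div_dvd_of_dvd hq))
    simp only [hp, hq, h4, if_true, if_false, Nat.mul_div_assoc _ hq]
    ring
  · simp only [hp, hq, if_false]
    ring

/-- A simultaneous eigenvector of all Hecke operators with `a₁ = 1` has multiplicative
coefficients. -/
lemma coeff_mul_of_heckeSeries_eq_smul {h : R⟦X⟧} (h1 : h.coeff 1 = 1) {χ : ℕ → R}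
    (he : ∀ p : ℕ, p.Prime → ∃ a : R, heckeSeries (χ p) p h = a • h) {m n : ℕ} (hm : 0 < m)
    (hmn : m.Coprime n) : h.coeff (m * n) = h.coeff m * h.coeff n := by
  have key : ∀ p : ℕ, p.Prime → ∀ r n : ℕ, p.Coprime n →
      h.coeff (p ^ r * n) = h.coeff (p ^ r) * h.coeff n := by
    intro p hp
    obtain ⟨a, ha⟩ := he p hp
    have hc : ∀ n, h.coeff (p * n) + χ p * (if p ∣ n then h.coeff (n / p) else 0) =
        a * h.coeff n := fun n ↦ by
      rw [← coeff_heckeSeries, ha, PowerSeries.coeff_smul, smul_eq_mul]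
    -- For `n` prime to `p`, the sequences `h(pʳn)` and `h(pʳ)h(n)` obey this same recurrence in `r`
    -- and have the same first two terms.
    have hstep : ∀ n, h.coeff (p * (p * n)) = a * h.coeff (p * n) - χ p * h.coeff n := fun n ↦ by
      have := hc (p * n)
      rw [if_pos (dvd_mul_right _ _), Nat.mul_div_cancel_left _ hp.pos] at this
      linear_combination this
    have hfirst : ∀ n, p.Coprime n → h.coeff (p * n) = a * h.coeff n := fun n hn ↦ by
      have := hc n
      rwa [if_neg ((Nat.Prime.coprime_iff_not_dvd hp).mp hn), mul_zero, add_zero] at this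
    have hp1 : h.coeff p = a := by simpa [h1] using hfirst 1 (Nat.coprime_one_right p)
    intro r
    induction r using Nat.strong_induction_on with
    | _ r ih =>
      intro n hn
      match r with
      | 0 => simp [h1]
      | 1 => rw [pow_one, hfirst n hn, hp1]
      | r + 2 =>
        have e1 := hstep (p ^ r * n)
        have e2 := hstep (p ^ r)
        have i1 := ih (r + 1) (by lia) n hn
        have i0 := ih r (by lia) n hn
        rw [show p * (p * (p ^ r * n)) = p ^ (r + 2) * n by ring,
          show p * (p ^ r * n) = p ^ (r + 1) * n by ring] at e1
        rw [show p * (p * p ^ r) = p ^ (r + 2) by ring,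
          show p * p ^ r = p ^ (r + 1) by ring] at e2
        rw [e1, e2, i1, i0]
        ring
  induction m using Nat.recOnPosPrimePosCoprime generalizing n with
  | prime_pow p r hp hr => exact key p hp r n (hmn.coprime_dvd_left (dvd_pow_self p hr.ne'))
  | zero => exact absurd hm (lt_irrefl 0)
  | one => simp [h1]
  | coprime a b ha hb hab iha ihb =>
    have ha' : a.Coprime n := hmn.coprime_dvd_left (dvd_mul_right a b)
    have hb' : b.Coprime n := hmn.coprime_dvd_left (dvd_mul_left b a)
    rw [mul_assoc, iha (by lia) (hab.mul_right ha'), ihb (by lia) hb', iha (by lia) hab, mul_assoc]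

end Algebraic

/-! ### Hecke action on `Δ` and `Δ²` over the integers -/

section IntegralHecke

/-- The modular discriminant as a modular form of weight `12`. -/
noncomputable def deltaForm : ModularForm 𝒮ℒ 12 := CuspForm.toModularFormₗ CuspForm.discriminant

/-- The square of the modular discriminant as a modular form of weight `24`. -/
noncomputable def deltaSqForm : ModularForm 𝒮ℒ 24 :=
  ModularForm.mcast (by norm_num) (deltaForm.mul deltaForm)

lemma qExpansion_deltaForm :
    qExpansion 1 deltaForm = deltaSeries.map (Int.castRingHom ℂ) := map_deltaSeries.symm

lemma qExpansion_deltaSqForm :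
    qExpansion 1 deltaSqForm = (deltaSeries ^ 2).map (Int.castRingHom ℂ) := by
  rw [deltaSqForm, ModularForm.qExpansion_mcast,
    ModularForm.qExpansion_mul one_pos one_mem_strictPeriods_SL, qExpansion_deltaForm, map_pow, sq]

lemma exists_smul_qExpansion_discriminant (f : ModularForm 𝒮ℒ 12)
    (h0 : (qExpansion 1 f).coeff 0 = 0) :
    ∃ c : ℂ, qExpansion 1 f = c • qExpansion 1 CuspForm.discriminant := by
  obtain ⟨c, hc⟩ := CuspForm.exists_smul_discriminant_of_weight_eq_twelve
    (ModularForm.toCuspForm f h0)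
  refine ⟨c, ?_⟩
  rw [← ModularForm.qExpansion_smul one_pos one_mem_strictPeriods_SL]
  exact congrArg (qExpansion 1) (congrArg DFunLike.coe hc).symm

/-- The weight is a variable because division by `Δ` produces a form of weight `24 - 12`. -/
lemma exists_qExpansion_eq_weight_twelve {k : ℤ} (hk : k = 12) (f : ModularForm 𝒮ℒ k) :
    ∃ a b : ℂ, qExpansion 1 f = a • qExpansion 1 (ModularForm.E (by norm_num : 3 ≤ 12)) +
      b • qExpansion 1 CuspForm.discriminant := by
  subst hk
  let E : ModularForm 𝒮ℒ 12 := ModularForm.E (by norm_num : 3 ≤ 12)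
  have hE : (qExpansion 1 E).coeff 0 = 1 :=
    EisensteinSeries.E_qExpansion_coeff_zero (by norm_num) ⟨6, rfl⟩
  set a := (qExpansion 1 f).coeff 0 with ha
  have hq : qExpansion 1 (f - a • E : ModularForm 𝒮ℒ 12) =
      qExpansion 1 f - a • qExpansion 1 E := by
    rw [FunLike.coe_sub, ModularForm.qExpansion_sub one_pos one_mem_strictPeriods_SL,
      FunLike.coe_smul, ModularForm.qExpansion_smul one_pos one_mem_strictPeriods_SL]
  obtain ⟨b, hb⟩ := exists_smul_qExpansion_discriminant (f - a • E)
    ((ModularForm.isCuspForm_iff_coeffZero_eq_zero _).mp (ModularForm.sub_smul_isCuspForm f E hE))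
  refine ⟨a, b, ?_⟩
  rw [← hb, hq]
  exact (add_sub_cancel _ _).symm

/-- Divide by `Δ` to land in weight 12; the factor 691 clears the denominator of `E₁₂`. -/
lemma exists_qExpansion_eq_weight_twentyFour (f : ModularForm 𝒮ℒ 24)
    (h0 : (qExpansion 1 f).coeff 0 = 0) :
    ∃ a b : ℂ, (691 : ℂ) • qExpansion 1 f =
      a • (deltaSeries * eisensteinTwelveSeries).map (Int.castRingHom ℂ) +
      b • (deltaSeries ^ 2).map (Int.castRingHom ℂ) := by
  obtain ⟨a, b, h⟩ := exists_qExpansion_eq_weight_twelve (by norm_num)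
    (CuspForm.discriminantEquiv (ModularForm.toCuspForm f h0))
  refine ⟨a, 691 * b, ?_⟩
  rw [ModularForm.qExpansion_eq_qExpansion_discriminant_mul f h0, h, map_mul, map_pow,
    ← mul_qExpansion_E_twelve, map_deltaSeries]
  simp only [PowerSeries.smul_eq_C_mul, map_mul]
  rw [show (691 : ℂ⟦X⟧) = PowerSeries.C 691 from rfl]
  simp only [CuspForm.coe_discriminant]
  ring

lemma heckeSeries_deltaSeries {p : ℕ} (hp : p.Prime) :
    heckeSeries ((p : ℤ) ^ 11) p deltaSeries = PowerSeries.C (deltaSeries.coeff p) * deltaSeries := by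
  have := Fact.mk hp
  have hq : qExpansion 1 (hecke p deltaForm) =
      (heckeSeries ((p : ℤ) ^ 11) p deltaSeries).map (Int.castRingHom ℂ) := by
    rw [qExpansion_hecke, qExpansion_deltaForm, map_heckeSeries]
    norm_num
  obtain ⟨c, hc⟩ := exists_smul_qExpansion_discriminant (hecke p deltaForm) (by
    rw [hq, PowerSeries.coeff_map, coeff_heckeSeries]
    simp only [mul_zero, Nat.zero_div, coeff_deltaSeries_zero]
    simp)
  rw [hq, ← map_deltaSeries] at hc
  have hcoef : ∀ n, ((heckeSeries ((p : ℤ) ^ 11) p deltaSeries).coeff n : ℂ) =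
      c * deltaSeries.coeff n := fun n ↦ by
    simpa using congrArg (PowerSeries.coeff n) hc
  have h1 := hcoef 1
  rw [coeff_heckeSeries, if_neg hp.not_dvd_one, coeff_deltaSeries_of_le_three.1] at h1
  ext n
  have hn := hcoef n
  have hcp : c = deltaSeries.coeff p := by simpa using h1.symm
  rw [hcp] at hn
  rw [PowerSeries.coeff_C_mul]
  exact_mod_cast hn

lemma coeff_sq_of_coeff_zero {R : Type*} [CommRing R] {h : R⟦X⟧} (h0 : h.coeff 0 = 0)
    (h1 : h.coeff 1 = 1) :
    (h ^ 2).coeff 0 = 0 ∧ (h ^ 2).coeff 1 = 0 ∧ (h ^ 2).coeff 2 = 1 ∧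
      (h ^ 2).coeff 4 = 2 * h.coeff 3 + h.coeff 2 ^ 2 := by
  simp [sq, PowerSeries.coeff_mul, Finset.Nat.antidiagonal_succ, h0, h1,
    -PowerSeries.coeff_zero_eq_constantCoeff]
  ring

lemma exists_mul_heckeSeries_deltaSeries_sq {p : ℕ} (hp : p.Prime) :
    ∃ a b : ℤ, PowerSeries.C 691 * heckeSeries ((p : ℤ) ^ 23) p (deltaSeries ^ 2) =
      PowerSeries.C a * (deltaSeries * eisensteinTwelveSeries) +
        PowerSeries.C b * deltaSeries ^ 2 := by
  have := Fact.mk hp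
  obtain ⟨hD0, hD1, hD2, -⟩ :=
    coeff_sq_of_coeff_zero coeff_deltaSeries_zero coeff_deltaSeries_of_le_three.1
  set H := heckeSeries ((p : ℤ) ^ 23) p (deltaSeries ^ 2) with hH
  have hq : qExpansion 1 (hecke p deltaSqForm) = H.map (Int.castRingHom ℂ) := by
    rw [qExpansion_hecke, qExpansion_deltaSqForm, map_heckeSeries]
    norm_num
  obtain ⟨a, b, h⟩ := exists_qExpansion_eq_weight_twentyFour (hecke p deltaSqForm) (by
    rw [hq, PowerSeries.coeff_map, hH, coeff_heckeSeries]
    simp only [mul_zero, Nat.zero_div, hD0]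
    simp)
  rw [hq] at h
  set P := deltaSeries * eisensteinTwelveSeries with hP
  have hcoef : ∀ n, 691 * (H.coeff n : ℂ) = a * P.coeff n + b * (deltaSeries ^ 2).coeff n :=
    fun n ↦ by
      have := congrArg (PowerSeries.coeff n) h
      simpa only [map_add, PowerSeries.coeff_smul, PowerSeries.coeff_map, smul_eq_mul,
        eq_intCast] using this
  have hP1 : P.coeff 1 = 691 := by
    have hG : eisensteinTwelveSeries.coeff 0 = 691 := by
      rw [eisensteinTwelveSeries, show (691 : ℤ⟦X⟧) = PowerSeries.C 691 from rfl,
        show (65520 : ℤ⟦X⟧) = PowerSeries.C 65520 from rfl, map_add, PowerSeries.coeff_C,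
        if_pos rfl, PowerSeries.coeff_C_mul, coeff_sigmaSeries_zero, mul_zero, add_zero]
    rw [hP, PowerSeries.coeff_mul]
    simp [Finset.Nat.antidiagonal_succ, coeff_deltaSeries_zero, coeff_deltaSeries_of_le_three, hG,
      -PowerSeries.coeff_zero_eq_constantCoeff]
  have ha : a = H.coeff 1 := by
    have h1 := hcoef 1
    rw [hP1, hD1] at h1
    push_cast at h1
    linear_combination (-1 / 691 : ℂ) * h1
  have h2 := hcoef 2
  rw [hD2, ha] at h2
  -- Since `P = 691q + ⋯` and `Δ² = q² + ⋯`, the coefficients of `q` and `q²` force these integer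
  -- values.
  refine ⟨H.coeff 1, 691 * H.coeff 2 - H.coeff 1 * P.coeff 2, ?_⟩
  ext n
  have hn := hcoef n
  have hb : b = ((691 * H.coeff 2 - H.coeff 1 * P.coeff 2 : ℤ) : ℂ) := by
    push_cast at h2 ⊢
    linear_combination -h2
  rw [ha, hb] at hn
  rw [map_add, PowerSeries.coeff_C_mul, PowerSeries.coeff_C_mul, PowerSeries.coeff_C_mul]
  exact_mod_cast hn

end IntegralHecke

/-! ### Eigenforms mod 13 -/

section ModThirteen

/-- The reduction mod `13` of the `q`-expansion of the discriminant. -/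
noncomputable def deltaBar : (ZMod 13)⟦X⟧ := deltaSeries.map (Int.castRingHom (ZMod 13))

lemma coeff_deltaBar : deltaBar.coeff 0 = 0 ∧ deltaBar.coeff 1 = 1 ∧ deltaBar.coeff 2 = 2 ∧
    deltaBar.coeff 3 = 5 := by
  obtain ⟨h1, h2, h3⟩ := coeff_deltaSeries_of_le_three
  simp only [deltaBar, PowerSeries.coeff_map, h1, h2, h3, coeff_deltaSeries_zero]
  decide

lemma heckeSeries_deltaBar {p : ℕ} (hp : p.Prime) :
    heckeSeries ((p : ZMod 13) ^ 11) p deltaBar = deltaBar.coeff p • deltaBar := by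
  have h := congrArg (PowerSeries.map (Int.castRingHom (ZMod 13))) (heckeSeries_deltaSeries hp)
  rw [map_heckeSeries, map_mul, PowerSeries.map_C] at h
  rw [PowerSeries.smul_eq_C_mul]
  simpa [deltaBar] using h

/-- `65520 = 13 · 5040` and `691 = 13 · 53 + 2`. -/
lemma map_eisensteinTwelveSeries :
    eisensteinTwelveSeries.map (Int.castRingHom (ZMod 13)) = PowerSeries.C 2 := by
  rw [eisensteinTwelveSeries, show (691 : ℤ⟦X⟧) = PowerSeries.C 691 from rfl,
    show (65520 : ℤ⟦X⟧) = PowerSeries.C 65520 from rfl, map_add, map_mul, PowerSeries.map_C,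
    PowerSeries.map_C, show Int.castRingHom (ZMod 13) 691 = 2 by decide,
    show Int.castRingHom (ZMod 13) 65520 = 0 by decide]
  simp

lemma exists_heckeSeries_deltaBar_sq {p : ℕ} (hp : p.Prime) :
    ∃ a b : ZMod 13, heckeSeries ((p : ZMod 13) ^ 11) p (deltaBar ^ 2) =
      a • deltaBar + b • deltaBar ^ 2 := by
  obtain ⟨a, b, hb⟩ := exists_mul_heckeSeries_deltaSeries_sq hp
  have h := congrArg (PowerSeries.map (Int.castRingHom (ZMod 13))) hb
  have hpow : ∀ x : ZMod 13, x ^ 23 = x ^ 11 := by decide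
  simp only [map_add, map_mul, map_pow, map_heckeSeries,
    PowerSeries.map_C, map_eisensteinTwelveSeries] at h
  rw [← deltaBar, show Int.castRingHom (ZMod 13) 691 = 2 by decide, map_natCast, hpow] at h
  -- The relation reads `2H = 2aΔ̄ + bΔ̄²`, and 7 inverts 2.
  refine ⟨a, 7 * b, ?_⟩
  have h7 : PowerSeries.C (7 : ZMod 13) * PowerSeries.C 2 = 1 := by
    rw [← map_mul, show (7 * 2 : ZMod 13) = 1 by decide, map_one]
  simp only [PowerSeries.smul_eq_C_mul, map_mul]
  simp only [eq_intCast] at h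
  linear_combination PowerSeries.C (7 : ZMod 13) * h +
    (PowerSeries.C (a : ZMod 13) * deltaBar -
      heckeSeries ((p : ZMod 13) ^ 11) p (deltaBar ^ 2)) * h7

lemma heckeSeries_two_deltaBar_sq :
    heckeSeries ((2 : ZMod 13) ^ 11) 2 (deltaBar ^ 2) = deltaBar - deltaBar ^ 2 := by
  obtain ⟨a, b, h⟩ := exists_heckeSeries_deltaBar_sq Nat.prime_two
  obtain ⟨h0, h1, h2, h3⟩ := coeff_deltaBar
  obtain ⟨-, s1, s2, s4⟩ := coeff_sq_of_coeff_zero h0 h1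
  have c1 := congrArg (PowerSeries.coeff 1) h
  have c2 := congrArg (PowerSeries.coeff 2) h
  simp only [coeff_heckeSeries, map_add, PowerSeries.coeff_smul, smul_eq_mul, s1, s2, s4, h1, h2,
    h3, Nat.reduceMul, Nat.reduceDiv, dvd_refl, if_true] at c1 c2
  rw [if_neg (by norm_num)] at c1
  have ha : a = 1 := by linear_combination -c1
  subst ha
  have hb : b = -1 := by
    have : (13 : ZMod 13) = 0 := by decide
    linear_combination -c2 + this
  subst hb
  rw [Nat.cast_ofNat] at h
  rw [h]
  simp [sub_eq_add_neg]

/-- The second normalized eigenform `Δ + 10 Δ²` mod `13` in weight `24`. -/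
noncomputable def eigenBar : (ZMod 13)⟦X⟧ := deltaBar + (10 : ZMod 13) • deltaBar ^ 2

/-- `T₂(Δ̄ + cΔ̄²) = (2 + c)Δ̄ - cΔ̄²`, so eigenvalue -1 requires `c = -3 = 10`. -/
lemma heckeSeries_two_eigenBar :
    heckeSeries ((2 : ZMod 13) ^ 11) 2 eigenBar = (-1 : ZMod 13) • eigenBar := by
  have h := heckeSeries_deltaBar Nat.prime_two
  rw [coeff_deltaBar.2.2.1, Nat.cast_ofNat] at h
  rw [eigenBar, heckeSeries_add, heckeSeries_smul, h, heckeSeries_two_deltaBar_sq, smul_add,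
    smul_sub, smul_smul, ← add_sub_assoc, ← add_smul, sub_eq_add_neg, ← _root_.neg_smul]
  exact congrArg₂ (fun a b : ZMod 13 ↦ a • deltaBar + b • deltaBar ^ 2) (by decide) (by decide)

lemma exists_heckeSeries_eigenBar {p : ℕ} (hp : p.Prime) :
    ∃ c : ZMod 13, heckeSeries ((p : ZMod 13) ^ 11) p eigenBar = c • eigenBar := by
  rcases eq_or_ne p 2 with rfl | hp2
  · exact ⟨-1, by simpa using heckeSeries_two_eigenBar⟩
  obtain ⟨a, b, h⟩ := exists_heckeSeries_deltaBar_sq hp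
  obtain ⟨h0, h1, h2, -⟩ := coeff_deltaBar
  obtain ⟨-, s1, -, -⟩ := coeff_sq_of_coeff_zero h0 h1
  set t := deltaBar.coeff p + 10 * a with ht
  have hv : heckeSeries ((p : ZMod 13) ^ 11) p eigenBar =
      t • deltaBar + (10 * b) • deltaBar ^ 2 := by
    rw [eigenBar, heckeSeries_add, heckeSeries_smul, h, heckeSeries_deltaBar hp, ht]
    simp only [smul_add, smul_smul, add_smul]
    abel
  have hcomm := heckeSeries_comm ((2 : ZMod 13) ^ 11) ((p : ZMod 13) ^ 11)
    ((Nat.coprime_primes Nat.prime_two hp).mpr hp2.symm) eigenBar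
  have hΔ := heckeSeries_deltaBar Nat.prime_two
  rw [h2, Nat.cast_ofNat] at hΔ
  rw [heckeSeries_two_eigenBar, heckeSeries_smul, hv, heckeSeries_add, heckeSeries_smul,
    heckeSeries_smul, hΔ, heckeSeries_two_deltaBar_sq] at hcomm
  have c1 := congrArg (PowerSeries.coeff 1) hcomm
  simp only [map_add, map_sub, PowerSeries.coeff_smul, smul_eq_mul, h1, s1] at c1
  have h13 : (13 : ZMod 13) = 0 := by decide
  -- `c1` says `2t + 10b = -t`, that is `3t = 3b`; 9 inverts 3, the difference of the two
  -- `T₂`-eigenvalues.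
  have htb : t = b := by linear_combination 9 * c1 - (2 * t + 7 * b) * h13
  refine ⟨b, ?_⟩
  rw [hv, htb, eigenBar, smul_add, smul_smul, mul_comm]

end ModThirteen

end LevelOneHecke

/-! ### The main theorem -/

open LevelOneHecke in
theorem mainTheorem9 :
    ∃ Δ : CuspForm 𝒮ℒ 12,
      (∀ g : CuspForm 𝒮ℒ 12, IsNormalizedCuspForm g ↔ g = Δ) ∧
      ∃ D : ℤ⟦X⟧,
        D.map (Int.castRingHom ℂ) = UpperHalfPlane.qExpansion 1 Δ ∧
        IsNormalizedMultiplicative (2 + D.map (Int.castRingHom (ZMod 13))) ∧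
        IsMultiplicativeSeries ((2 + D.map (Int.castRingHom (ZMod 13))) ^ 2) := by
  obtain ⟨h0, h1, -, -⟩ := coeff_deltaBar
  obtain ⟨s0, s1, -, -⟩ := coeff_sq_of_coeff_zero h0 h1
  have hconst : ∀ (c : ZMod 13) (h : (ZMod 13)⟦X⟧) (n : ℕ), 0 < n →
      (PowerSeries.C c + h).coeff n = h.coeff n := fun c h n hn ↦ by
    rw [map_add, PowerSeries.coeff_C, if_neg hn.ne', zero_add]
  -- The scalar 10 is the inverse of 4, the `q`-coefficient of `f̄²`.
  refine ⟨CuspForm.discriminant, fun g ↦ ⟨fun hg ↦ ?_, ?_⟩, deltaSeries, map_deltaSeries, ?_, 10, ?_⟩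
  · obtain ⟨c, rfl⟩ := CuspForm.exists_smul_discriminant_of_weight_eq_twelve g
    have h := ModularForm.qExpansion_smul one_pos one_mem_strictPeriods_SL c
      CuspForm.discriminant
    have hc : c = 1 := by
      have h' := congrArg (PowerSeries.coeff 1) h
      rw [PowerSeries.coeff_smul, CuspForm.coe_discriminant,
        ModularForm.discriminant_qExpansion_coeff_one, smul_eq_mul, mul_one] at h'
      exact h'.symm.trans hg
    rw [hc, one_smul]
  · rintro rfl
    exact ModularForm.discriminant_qExpansion_coeff_one
  · rw [← deltaBar, show (2 : (ZMod 13)⟦X⟧) = PowerSeries.C 2 from rfl]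
    -- `2 · 10 · 2 = 40 = 1` mod 13.
    refine ⟨⟨10, ?_⟩, ?_, fun m n hm hn hmn ↦ ?_⟩
    · rw [map_add, h0, PowerSeries.coeff_C, if_pos rfl]
      decide
    · rw [hconst _ _ _ one_pos, h1]
    · rw [hconst _ _ _ (Nat.mul_pos hm hn), hconst _ _ _ hm, hconst _ _ _ hn]
      exact coeff_mul_of_heckeSeries_eq_smul h1 (χ := fun p ↦ (p : ZMod 13) ^ 11)
        (fun p hp ↦ ⟨_, heckeSeries_deltaBar hp⟩) hm hmn
  · have hsq : (10 : ZMod 13) • (2 + deltaBar) ^ 2 = PowerSeries.C 1 + eigenBar := by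
      have h40 : PowerSeries.C (10 : ZMod 13) * PowerSeries.C 4 = 1 := by
        rw [← map_mul, show (10 * 4 : ZMod 13) = 1 by decide, map_one]
      rw [show PowerSeries.C (4 : ZMod 13) = 4 from rfl] at h40
      rw [eigenBar, PowerSeries.smul_eq_C_mul, PowerSeries.smul_eq_C_mul, map_one]
      linear_combination (1 + deltaBar) * h40
    rw [← deltaBar, hsq]
    have e1 : eigenBar.coeff 1 = 1 := by
      rw [eigenBar, map_add, PowerSeries.coeff_smul, h1, s1, smul_zero, add_zero]
    refine ⟨⟨7, ?_⟩, ?_, fun m n hm hn hmn ↦ ?_⟩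
    · rw [map_add, eigenBar, map_add, PowerSeries.coeff_smul, h0, s0, PowerSeries.coeff_C,
        if_pos rfl]
      decide
    · rw [hconst _ _ _ one_pos, e1]
    · rw [hconst _ _ _ (Nat.mul_pos hm hn), hconst _ _ _ hm, hconst _ _ _ hn]
      exact coeff_mul_of_heckeSeries_eq_smul e1 (χ := fun p ↦ (p : ZMod 13) ^ 11)
        (fun p hp ↦ exists_heckeSeries_eigenBar hp) hm hmn
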